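/- Let $k,l$ be positive integers with $l<k$, let $d=\gcd(l,k)$ and $k=nd$ (so $n>1$), and let $\mathrm{GF}(2^k)$ be a finite field with $2^k$ elements. For $a\in\mathrm{GF}(2^k)$ put $P_a(x)=x^{2^l+1}+x+a$. Define polynomials over $\mathrm{GF}(2^k)$ by \[C_0(x)=0,\qquad C_1(x)=C_2(x)=1,\qquad C_{i+2}(x)=C_{i+1}(x)+x^{2^{il}}C_i(x)\quad(i\ge 1),\] and $Z_n(x)=C_{n+1}(x)+x\,C_{n-1}(x)^{2^l}$. Let $M_1$ be the number of $a\in\mathrm{GF}(2^k)\setminus\{0\}$ such that $P_a(x)$ has exactly one zero in $\mathrm{GF}(2^k)$. **Proposition.** For every $a\in\mathrm{GF}(2^k)\setminus\{0\}$, the polynomial $P_a(x)$ has exactly one zero in $\mathrm{GF}(2^k)$ if and only if $Z_n(a)=0$ and $C_n(a)\neq 0$; in that case the zero is equal to \[\left(a\,C_n(a)^{2^l-1}\right)^{2^{k-1}}.\] Moreover, $M_1=2^{k-d}-1$ if $n$ is odd, and $M_1=2^{k-d}$ if $n$ is even. -/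

import Mathlib

open Polynomial

noncomputable section

/-- The polynomial `P_a(x) = x^(2^l + 1) + x + a`. -/
def polyP {F : Type*} [Field F] (l : ℕ) (a : F) : F[X] :=
  X ^ (2 ^ l + 1) + X + C a

/-- The polynomials `C_i(x)`: `C_1 = C_2 = 1` and `C_{i+2} = C_{i+1} + x_i C_i` for `i ≥ 1`, where
`x_i = x^(2^(i l))`. With the convention `C_0 = 0` the recursion also holds for `i = 0`. -/
def polyC (F : Type*) [Field F] (l : ℕ) : ℕ → F[X]
  | 0 => 0
  | 1 => 1
  | i + 2 => polyC F l (i + 1) + X ^ (2 ^ (i * l)) * polyC F l i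

/-- The polynomials `Z_n(x) = C_{n+1}(x) + x C_{n-1}(x)^(2^l)`; in particular `Z_1 = 1`. -/
def polyZ (F : Type*) [Field F] (l n : ℕ) : F[X] :=
  polyC F l (n + 1) + X * polyC F l (n - 1) ^ (2 ^ l)

/-- The set of zeros of `P_a` in the field `F`. -/
def zerosP {F : Type*} [Field F] (l : ℕ) (a : F) : Set F :=
  {x | (polyP l a).eval x = 0}

/-- `M_i`, the number of nonzero `a` in `F` such that `P_a` has exactly `i` zeros in `F`
(meaningful for a finite field `F`). -/
def countM (F : Type*) [Field F] (l i : ℕ) : ℕ :=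
  {a : F | a ≠ 0 ∧ (zerosP l a).ncard = i}.ncard

end

theorem polyC_two (F : Type*) [Field F] (l : ℕ) : polyC F l 2 = 1 := by
  simp [polyC]

theorem polyZ_one (F : Type*) [Field F] (l : ℕ) : polyZ F l 1 = 1 := by
  simp [polyZ, polyC]

/-! Let σ be x ↦ x^(2^l), of order n on F; zeros of P_a satisfy x σ(x) + x + a = 0. Partial norms of
a zero obey the recursion of the C_i, and σ^n = id then gives C_n x² + Z_n x + a σ(C_n) = 0. If Z_n
= 0 and C_n ≠ 0, this determines x, as squaring is bijective, and the square root so found is indeed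
a zero (`zero_of_twistedTrace_eq_zero`).

Conversely, zeros other than x have the form x + 1/u with u solving an affine equation. If x is the
only zero, the linear part of that equation is singular, which yields s with x = σ(s)/(s + σ(s)).
Then x and x + 1 = s/(s + σ(s)) have equal norms, so Z_n = N(x) + N(x + 1) = 0. Moreover C_n
vanishes exactly when Tr(1/s) does, and then additive Hilbert 90 would produce a second zero.

Hence the a in question correspond to the s with σ(s) ≠ s and Tr(1/s) ≠ 0, up to scaling by the
nonzero fixed elements of σ; counting these s gives M_1 (`card_parameters_eq`,
`card_parameters_add`). The parity of n enters because a fixed c has trace n c. -/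

/-! ### Twisted continuants, norms and traces. -/

section Semilinear

variable {F : Type*} [Field F]

/-- The sequence `c 0 = 0`, `c 1 = 1`, `c (i + 2) = c (i + 1) + σ^i(a) * c i`. -/
def twistedFib (σ : F →+* F) (a : F) : ℕ → F
  | 0 => 0
  | 1 => 1
  | i + 2 => twistedFib σ a (i + 1) + σ^[i] a * twistedFib σ a i

theorem twistedFib_add_two (σ : F →+* F) (a : F) (i : ℕ) :
    twistedFib σ a (i + 2) = twistedFib σ a (i + 1) + σ^[i] a * twistedFib σ a i := by
  rw [twistedFib]

/-- The left side is a continuant in σ(a), …, σ^i(a); the definition peels off the last variable,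
this the first. -/
theorem twistedFib_add_two' (σ : F →+* F) (a : F) (i : ℕ) :
    twistedFib σ a (i + 2) =
      σ (twistedFib σ a (i + 1)) + σ a * σ (σ (twistedFib σ a i)) := by
  induction i using Nat.twoStepInduction with
  | zero => simp [twistedFib]
  | one => simp [twistedFib]
  | more i h0 h1 =>
    have e1 := twistedFib_add_two σ a (i + 2)
    have e2 := congrArg σ (twistedFib_add_two σ a (i + 1))
    have e3 := congrArg (fun t => σ (σ t)) (twistedFib_add_two σ a i)
    simp only [map_add, map_mul, Function.iterate_succ_apply'] at e1 e2 e3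
    linear_combination e1 - e2 - σ a * e3 + h1 + σ (σ (σ^[i] a)) * h0

/-- The trace of the twisted product of the matrices `!![1, a; 1, 0]`. -/
def twistedTrace (σ : F →+* F) (a : F) (n : ℕ) : F :=
  twistedFib σ a (n + 1) + a * σ (twistedFib σ a (n - 1))

/-- The norm attached to a ring endomorphism of order `n`. -/
def twistedNorm (σ : F →+* F) (n : ℕ) (x : F) : F := ∏ j ∈ Finset.range n, σ^[j] x

/-- The trace form attached to a ring endomorphism of order `n`. -/
def additiveTrace (σ : F →+* F) (n : ℕ) : F →+ F where
  toFun x := ∑ j ∈ Finset.range n, σ^[j] x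
  map_zero' := by simp
  map_add' x y := by simp [Finset.sum_add_distrib]

theorem additiveTrace_apply (σ : F →+* F) (n : ℕ) (x : F) :
    additiveTrace σ n x = ∑ j ∈ Finset.range n, σ^[j] x := rfl

theorem additiveTrace_map {σ : F →+* F} {n : ℕ} (hσ : ∀ x, σ^[n] x = x) (x : F) :
    additiveTrace σ n (σ x) = additiveTrace σ n x := by
  have h1 := Finset.sum_range_succ (fun j => σ^[j] x) n
  rw [Finset.sum_range_succ', hσ] at h1
  simpa [additiveTrace_apply] using h1

theorem map_additiveTrace {σ : F →+* F} {n : ℕ} (hσ : ∀ x, σ^[n] x = x) (x : F) :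
    σ (additiveTrace σ n x) = additiveTrace σ n x := by
  conv_rhs => rw [← additiveTrace_map hσ]
  simp [additiveTrace_apply, map_sum, ← Function.iterate_succ_apply', Function.iterate_succ_apply]

theorem iterate_eq_of_map_eq {σ : F →+* F} {c : F} (hc : σ c = c) (j : ℕ) : σ^[j] c = c :=
  Function.iterate_fixed hc j

theorem additiveTrace_mul {σ : F →+* F} (n : ℕ) {c : F} (hc : σ c = c) (x : F) :
    additiveTrace σ n (c * x) = c * additiveTrace σ n x := by
  simp [additiveTrace_apply, Finset.mul_sum, iterate_map_mul, iterate_eq_of_map_eq hc]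

theorem twistedNorm_mul (σ : F →+* F) (n : ℕ) (x y : F) :
    twistedNorm σ n (x * y) = twistedNorm σ n x * twistedNorm σ n y := by
  simp [twistedNorm, iterate_map_mul, Finset.prod_mul_distrib]

theorem twistedNorm_map {σ : F →+* F} {n : ℕ} (hσ : ∀ x, σ^[n] x = x) {x : F} (hx : x ≠ 0) :
    twistedNorm σ n (σ x) = twistedNorm σ n x := by
  have h1 := Finset.prod_range_succ (fun j => σ^[j] x) n
  rw [Finset.prod_range_succ', hσ] at h1
  simpa [twistedNorm, hx] using h1

theorem iterate_inv (σ : F →+* F) (j : ℕ) (x : F) : σ^[j] x⁻¹ = (σ^[j] x)⁻¹ := by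
  induction j with
  | zero => rfl
  | succ j ih => rw [Function.iterate_succ_apply', ih, map_inv₀, Function.iterate_succ_apply']

theorem iterate_ne_zero (σ : F →+* F) (j : ℕ) {x : F} (hx : x ≠ 0) : σ^[j] x ≠ 0 := by
  intro h
  exact hx ((σ.injective.iterate j) (by rw [h, iterate_map_zero]))

theorem twistedNorm_ne_zero (σ : F →+* F) (n : ℕ) {x : F} (hx : x ≠ 0) :
    twistedNorm σ n x ≠ 0 :=
  Finset.prod_ne_zero_iff.2 fun j _ => iterate_ne_zero σ j hx

variable [CharP F 2] {σ : F →+* F} {a : F}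

theorem twistedNorm_eq_of_zero {y : F} (hy : y * σ y + y + a = 0) (i : ℕ) :
    twistedNorm σ (i + 1) y = y * twistedFib σ a (i + 1) + a * σ (twistedFib σ a i) := by
  have hy' : y * σ y = y + a := by
    rw [← sub_eq_zero, CharTwo.sub_eq_add, ← hy]; ring
  -- Apply σ^i to y σ(y) = y + a: partial norms obey the recursion of `twistedFib`.
  have step (i : ℕ) : twistedNorm σ (i + 2) y =
      twistedNorm σ (i + 1) y + σ^[i] a * twistedNorm σ i y := by
    have h := congrArg (σ^[i]) hy'
    rw [iterate_map_mul, iterate_map_add, ← Function.iterate_succ_apply] at h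
    simp only [twistedNorm, Finset.prod_range_succ]
    rw [mul_assoc, h]; ring
  induction i using Nat.twoStepInduction with
  | zero => simp [twistedNorm, twistedFib]
  | one => simp [twistedNorm, twistedFib, Finset.prod_range_succ, hy']
  | more i h0 h1 =>
    rw [step (i + 1), h0, h1, twistedFib_add_two σ a (i + 1), twistedFib_add_two σ a i]
    simp only [map_add, map_mul, Function.iterate_succ_apply']
    ring

/-- Since a = y (σ(y) + 1), the second-order recursion factors, and raising i multiplies the left
side by σ^i(σ(y) + 1). -/
theorem twistedFib_succ_add_of_zero {y : F} (hy : y * σ y + y + a = 0) (i : ℕ) :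
    twistedFib σ a (i + 1) + σ^[i] y * twistedFib σ a i = twistedNorm σ i (σ y + 1) := by
  induction i with
  | zero => simp [twistedFib, twistedNorm]
  | succ i ih =>
    have ha : a = y * (σ y + 1) := by
      rw [← sub_eq_zero, CharTwo.sub_eq_add, ← hy]; ring
    have h : σ^[i] a = σ^[i] y * (σ^[i + 1] y + 1) := by
      conv_lhs => rw [ha]
      rw [iterate_map_mul, iterate_map_add, iterate_map_one, ← Function.iterate_succ_apply]
    rw [twistedNorm, Finset.prod_range_succ, ← twistedNorm, ← ih, twistedFib_add_two, h,
      iterate_map_add, iterate_map_one, ← Function.iterate_succ_apply]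
    ring

theorem twistedTrace_eq_of_zero {n : ℕ} (hn : n ≠ 0) (hσ : ∀ x, σ^[n] x = x) {y : F}
    (hy : y * σ y + y + a = 0) (hy1 : y + 1 ≠ 0) :
    twistedTrace σ a n = twistedNorm σ n y + twistedNorm σ n (y + 1) := by
  have h1 := twistedFib_succ_add_of_zero hy n
  obtain ⟨m, rfl⟩ := Nat.exists_eq_succ_of_ne_zero hn
  have h2 := twistedNorm_eq_of_zero hy m
  have h3 := twistedNorm_map hσ hy1
  rw [map_add, map_one] at h3
  rw [hσ, h3] at h1
  simp only [Nat.succ_eq_add_one] at *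
  rw [h2, ← h1, twistedTrace, Nat.add_sub_cancel]
  linear_combination -y * twistedFib σ a (m + 1) * CharTwo.two_eq_zero (R := F)

/-- The product of n + 1 conjugates of y is also y times the product of n of them; expand both by
`twistedNorm_eq_of_zero`. -/
theorem quadratic_of_zero {n : ℕ} (hn : n ≠ 0) (hσ : ∀ x, σ^[n] x = x) {y : F}
    (hy : y * σ y + y + a = 0) :
    twistedFib σ a n * y ^ 2 + twistedTrace σ a n * y + a * σ (twistedFib σ a n) = 0 := by
  obtain ⟨m, rfl⟩ := Nat.exists_eq_succ_of_ne_zero hn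
  have h1 := twistedNorm_eq_of_zero hy m
  have h2 := twistedNorm_eq_of_zero hy (m + 1)
  rw [twistedNorm, Finset.prod_range_succ, ← twistedNorm, hσ, h1] at h2
  rw [twistedTrace, Nat.succ_eq_add_one, Nat.add_sub_cancel]
  linear_combination h2 + (y * twistedFib σ a (m + 1 + 1) +
    a * σ (twistedFib σ a (m + 1))) * CharTwo.two_eq_zero (R := F)

theorem zero_of_twistedTrace_eq_zero {n : ℕ} (hn : n ≠ 0) (hσ : ∀ x, σ^[n] x = x)
    (hZ : twistedTrace σ a n = 0) (hC : twistedFib σ a n ≠ 0) {x : F}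
    (hx : x ^ 2 * twistedFib σ a n = a * σ (twistedFib σ a n)) :
    x * σ x + x + a = 0 := by
  have h2 := CharTwo.two_eq_zero (R := F)
  obtain ⟨m, rfl⟩ := Nat.exists_eq_succ_of_ne_zero hn
  have e1 := twistedFib_add_two' σ a (m + 1)
  rw [twistedFib_add_two, hσ] at e1
  have e2 := congrArg σ (twistedFib_add_two σ a m)
  rw [map_add, map_mul, ← Function.iterate_succ_apply' (f := σ), hσ] at e2
  simp only [twistedTrace, Nat.succ_eq_add_one, Nat.add_sub_cancel] at *
  set c := twistedFib σ a (m + 1)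
  -- Equate the two expansions of C_{n+2}, using σ^n = id and Z_n = 0.
  have key : σ a * σ (σ c) + σ c + a * c = 0 := by
    linear_combination -e1 - e2 + hZ + (a * c - a * σ (twistedFib σ a m)) * h2
  have hx' := congrArg σ hx
  rw [map_mul, map_pow, map_mul] at hx'
  have hσc : σ c ≠ 0 := by simpa using hC
  have : (x * σ x + x + a) ^ 2 * (c * σ c) = 0 := by
    linear_combination (σ x ^ 2 * σ c) * hx + (a * σ c) * hx' + σ c * hx + a * σ c * key +
      (x * σ x * x + x * σ x * a + x * a) * c * σ c * h2
  simpa [hC, hσc] using this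

end Semilinear

/-! ### Zeros of the form σ(s)/(s + σ(s)). -/

section Parametrization

variable {F : Type*} [Field F] [CharP F 2] {σ : F →+* F} {a : F}

/-- `twistedFib_succ_add_of_zero` is a first-order recursion for `twistedFib`; after clearing norms,
each step adds one term to the trace of 1/σ(s). -/
theorem twistedFib_mul_twistedNorm {s x : F} (hs0 : s ≠ 0)
    (hx : x * (s + σ s) = σ s) (hy : x * σ x + x + a = 0) (i : ℕ) :
    twistedFib σ a (i + 1) * twistedNorm σ i (σ s + σ (σ s)) =
      twistedNorm σ (i + 1) (σ s) * additiveTrace σ (i + 1) (σ s)⁻¹ := by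
  have h2 := CharTwo.two_eq_zero (R := F)
  have hx' := congrArg σ hx
  rw [map_mul, map_add] at hx'
  have hσs : σ s ≠ 0 := by simpa using hs0
  induction i with
  | zero => simp [twistedFib, twistedNorm, additiveTrace_apply, hσs]
  | succ i ih =>
    have hB := twistedFib_succ_add_of_zero hy (i + 1)
    have hN : twistedNorm σ (i + 1) (σ x + 1) * twistedNorm σ (i + 1) (σ s + σ (σ s)) =
        twistedNorm σ (i + 1) (σ s) := by
      rw [← twistedNorm_mul]
      congr 1
      linear_combination hx' + σ (σ s) * h2
    have hxi := congrArg (σ^[i]) hx'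
    rw [iterate_map_mul, ← Function.iterate_succ_apply (f := σ),
      ← Function.iterate_succ_apply (f := σ)] at hxi
    have hW : twistedNorm σ (i + 1) (σ s + σ (σ s)) =
        twistedNorm σ i (σ s + σ (σ s)) * σ^[i] (σ s + σ (σ s)) := by
      rw [twistedNorm, Finset.prod_range_succ, ← twistedNorm]
    have hN2 : twistedNorm σ (i + 1 + 1) (σ s) =
        twistedNorm σ (i + 1) (σ s) * σ^[i + 1] (σ s) := by
      rw [twistedNorm, Finset.prod_range_succ, ← twistedNorm]
    have hT : additiveTrace σ (i + 1 + 1) (σ s)⁻¹ =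
        additiveTrace σ (i + 1) (σ s)⁻¹ + (σ^[i + 1] (σ s))⁻¹ := by
      rw [additiveTrace_apply, Finset.sum_range_succ, ← additiveTrace_apply, iterate_inv]
    have hne : σ^[i + 1] (σ s) ≠ 0 := iterate_ne_zero σ _ hσs
    have e : twistedNorm σ (i + 1 + 1) (σ s) * additiveTrace σ (i + 1 + 1) (σ s)⁻¹ =
        twistedNorm σ (i + 1) (σ s) * σ^[i + 1] (σ s) * additiveTrace σ (i + 1) (σ s)⁻¹ +
          twistedNorm σ (i + 1) (σ s) := by
      rw [hN2, hT]; field_simp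
    rw [e, ← hN]
    rw [hN, mul_right_comm, ← ih, ← hxi, ← hN, ← hB, hW]
    linear_combination (-(σ^[i + 1] x * twistedFib σ a (i + 1) *
      twistedNorm σ i (σ s + σ (σ s)) * σ^[i] (σ s + σ (σ s)))) * h2

theorem twistedFib_ne_zero_iff {n : ℕ} (hn : n ≠ 0) (hσ : ∀ x, σ^[n] x = x) {s x : F}
    (hs : s + σ s ≠ 0) (hs0 : s ≠ 0) (hx : x * (s + σ s) = σ s)
    (hy : x * σ x + x + a = 0) :
    twistedFib σ a n ≠ 0 ↔ additiveTrace σ n s⁻¹ ≠ 0 := by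
  obtain ⟨m, rfl⟩ := Nat.exists_eq_succ_of_ne_zero hn
  have h := twistedFib_mul_twistedNorm hs0 hx hy m
  rw [← map_inv₀, additiveTrace_map hσ, ← map_add] at h
  have h1 := twistedNorm_ne_zero σ m (x := σ (s + σ s)) ((map_ne_zero σ).2 hs)
  have h2 := twistedNorm_ne_zero σ (m + 1) (x := σ s) (by simpa using hs0)
  rw [not_iff_not]
  constructor
  · intro h0
    rw [h0, zero_mul] at h
    simpa [h2] using h.symm
  · intro h0
    rw [h0, mul_zero] at h
    exact (mul_eq_zero.1 h).resolve_right h1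

theorem twistedTrace_eq_zero {n : ℕ} (hn : n ≠ 0) (hσ : ∀ x, σ^[n] x = x) {s x : F}
    (hs : s + σ s ≠ 0) (hs0 : s ≠ 0) (hx : x * (s + σ s) = σ s)
    (hy : x * σ x + x + a = 0) :
    twistedTrace σ a n = 0 := by
  have h2 := CharTwo.two_eq_zero (R := F)
  have hx1 : (x + 1) * (s + σ s) = s := by linear_combination hx + σ s * h2
  rw [twistedTrace_eq_of_zero hn hσ hy (by rintro h; rw [h, zero_mul] at hx1; exact hs0 hx1.symm)]
  have e1 := congrArg (twistedNorm σ n) hx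
  have e2 := congrArg (twistedNorm σ n) hx1
  rw [twistedNorm_mul] at e1 e2
  rw [twistedNorm_map hσ hs0, ← e2] at e1
  rw [mul_right_cancel₀ (twistedNorm_ne_zero σ n hs) e1, CharTwo.add_self_eq_zero]

/-- The Riccati substitution: around a known zero, the equation becomes affine in u. -/
theorem add_inv_is_zero {x u : F} (hy : x * σ x + x + a = 0)
    (hu : (σ x + 1) * σ u + x * u = 1) :
    (x + u⁻¹) * σ (x + u⁻¹) + (x + u⁻¹) + a = 0 := by
  have h2 := CharTwo.two_eq_zero (R := F)
  have hu0 : u ≠ 0 := by rintro rfl; simp at hu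
  have hσu : σ u ≠ 0 := by simpa using hu0
  rw [map_add, map_inv₀]
  field_simp
  linear_combination hu + u * σ u * hy + h2

theorem exists_parameter_of_unique_zero [Finite F] {x : F} (hy : x * σ x + x + a = 0)
    (ha : a ≠ 0) (huniq : ∀ y, y * σ y + y + a = 0 → y = x) :
    ∃ s, s + σ s ≠ 0 ∧ s ≠ 0 ∧ x * (s + σ s) = σ s := by
  have h2 := CharTwo.two_eq_zero (R := F)
  have hx0 : x ≠ 0 := by rintro rfl; simp at hy; exact ha hy
  let L : F →+ F := (AddMonoidHom.mulLeft (σ x + 1)).comp σ.toAddMonoidHom + AddMonoidHom.mulLeft x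
  have hL (u : F) : L u = (σ x + 1) * σ u + x * u := rfl
  have hns : ¬ Function.Surjective L := by
    intro h
    obtain ⟨u, hu⟩ := h 1
    rw [hL] at hu
    have h := huniq _ (add_inv_is_zero hy hu)
    have : u = 0 := by simpa using h
    simp [this] at hu
  have hni : ¬ Function.Injective L := fun h => hns (Finite.surjective_of_injective h)
  rw [injective_iff_map_eq_zero] at hni
  push Not at hni
  obtain ⟨u, hu, hu0⟩ := hni
  rw [hL] at hu
  have e : σ (x * u + u) = x * u := by
    rw [map_add, map_mul]; linear_combination hu - x * u * h2
  have e1 : (x * u + u) + σ (x * u + u) = u := by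
    rw [e]; linear_combination x * u * h2
  -- With u in the kernel of L, s = (x + 1) u has σ(s) = x u and s + σ(s) = u.
  refine ⟨x * u + u, by rwa [e1], ?_, by rw [e1, e]⟩
  intro h
  rw [h, map_zero] at e
  exact mul_ne_zero hx0 hu0 e.symm

/-- Putting u = (s + σ(s)) v turns the affine equation of `add_inv_is_zero` into σ(v) + v = 1/σ(s).
-/
theorem exists_second_zero {s x v : F} (hs0 : s ≠ 0)
    (hx : x * (s + σ s) = σ s) (hy : x * σ x + x + a = 0) (hv : σ v + v = (σ s)⁻¹) :
    ∃ y, y * σ y + y + a = 0 ∧ y ≠ x := by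
  have h2 := CharTwo.two_eq_zero (R := F)
  have hσs : σ s ≠ 0 := by simpa using hs0
  have hx' := congrArg σ hx
  rw [map_mul, map_add] at hx'
  have hu : (σ x + 1) * σ ((s + σ s) * v) + x * ((s + σ s) * v) = 1 := by
    rw [map_mul, map_add]
    have : σ s * (σ v + v) = 1 := by rw [hv, mul_inv_cancel₀ hσs]
    linear_combination this + σ v * hx' + v * hx + σ v * σ (σ s) * h2
  refine ⟨_, add_inv_is_zero hy hu, ?_⟩
  intro h
  have : (s + σ s) * v = 0 := inv_eq_zero.1 (left_eq_add.1 h.symm)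
  simp [this] at hu

end Parametrization

/-! ### The trace onto the fixed field and additive Hilbert 90. -/

section FixedField

variable {F : Type*} [Field F]

theorem AddMonoidHom.card_ker_mul_card_range {G H : Type*} [AddGroup G] [AddGroup H]
    (f : G →+ H) : Nat.card f.ker * Nat.card f.range = Nat.card G := by
  rw [← AddSubgroup.index_ker, AddSubgroup.card_mul_index]

/-- Dedekind independence of the distinct characters σ^0, …, σ^(n-1). -/
theorem additiveTrace_ne_zero {σ : F →+* F} {n : ℕ} (hn : n ≠ 0)
    (hmin : ∀ m, 0 < m → m < n → ∃ x, σ^[m] x ≠ x) : ∃ x, additiveTrace σ n x ≠ 0 := by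
  by_contra! h
  let f : Fin n → (F →* F) := fun j => ((σ ^ (j : ℕ) : F →+* F) : F →* F)
  have hf (j : Fin n) (x : F) : f j x = σ^[j] x := by simp [f, RingHom.coe_pow]
  have key (i j : Fin n) (hij : i < j) : f i ≠ f j := by
    intro e
    obtain ⟨x, hx⟩ := hmin (j - i) (by omega) (by omega)
    apply hx
    apply σ.injective.iterate i
    rw [← Function.iterate_add_apply, Nat.add_sub_cancel' hij.le, ← hf, ← hf, e]
  have hinj : Function.Injective f := by
    intro i j e
    rcases lt_trichotomy i j with hij | hij | hij
    · exact absurd e (key i j hij)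
    · exact hij
    · exact absurd e.symm (key j i hij)
  have hli := (linearIndependent_monoidHom F F).comp f hinj
  rw [Fintype.linearIndependent_iff] at hli
  refine one_ne_zero (hli (fun _ => 1) ?_ ⟨0, Nat.pos_of_ne_zero hn⟩)
  ext x
  have := h x
  rw [additiveTrace_apply, ← Fin.sum_univ_eq_sum_range (fun j => σ^[j] x)] at this
  simpa [hf] using this

/-- The additive map `x ↦ σ x + x`, whose kernel is the fixed field of `σ` in characteristic two. -/
def addSelfMap (σ : F →+* F) : F →+ F := σ.toAddMonoidHom + AddMonoidHom.id F

theorem addSelfMap_apply (σ : F →+* F) (x : F) : addSelfMap σ x = σ x + x := rfl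

variable [CharP F 2] {σ : F →+* F}

theorem mem_ker_addSelfMap {x : F} : x ∈ (addSelfMap σ).ker ↔ σ x = x := by
  rw [AddMonoidHom.mem_ker, addSelfMap_apply, CharTwo.add_eq_zero]

theorem range_additiveTrace {n : ℕ} (hn : n ≠ 0) (hσ : ∀ x, σ^[n] x = x)
    (hmin : ∀ m, 0 < m → m < n → ∃ x, σ^[m] x ≠ x) :
    (additiveTrace σ n).range = (addSelfMap σ).ker := by
  ext y
  rw [mem_ker_addSelfMap, AddMonoidHom.mem_range]
  constructor
  · rintro ⟨x, rfl⟩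
    exact map_additiveTrace hσ x
  · intro hy
    obtain ⟨x, hx⟩ := additiveTrace_ne_zero hn hmin
    refine ⟨(y * (additiveTrace σ n x)⁻¹) * x, ?_⟩
    rw [additiveTrace_mul n, inv_mul_cancel_right₀ hx]
    rw [map_mul, hy, map_inv₀, map_additiveTrace hσ]

theorem card_ker_additiveTrace_mul {n : ℕ} (hn : n ≠ 0) (hσ : ∀ x, σ^[n] x = x)
    (hmin : ∀ m, 0 < m → m < n → ∃ x, σ^[m] x ≠ x) :
    Nat.card (additiveTrace σ n).ker * Nat.card (addSelfMap σ).ker = Nat.card F := by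
  rw [← range_additiveTrace hn hσ hmin, AddMonoidHom.card_ker_mul_card_range]

/-- The image of σ + id lies in the kernel of the trace, and both have |F| divided by the size of
the fixed field as cardinality. -/
theorem exists_add_eq_of_additiveTrace_eq_zero [Finite F] {n : ℕ} (hn : n ≠ 0)
    (hσ : ∀ x, σ^[n] x = x) (hmin : ∀ m, 0 < m → m < n → ∃ x, σ^[m] x ≠ x) {x : F}
    (hx : additiveTrace σ n x = 0) : ∃ v, σ v + v = x := by
  have h1 := card_ker_additiveTrace_mul hn hσ hmin
  rw [← AddMonoidHom.card_ker_mul_card_range (addSelfMap σ), mul_comm] at h1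
  have h2 := Nat.eq_of_mul_eq_mul_left Nat.card_pos h1
  have hle : (addSelfMap σ).range ≤ (additiveTrace σ n).ker := by
    rintro _ ⟨v, rfl⟩
    rw [AddMonoidHom.mem_ker, addSelfMap_apply, map_add, additiveTrace_map hσ,
      CharTwo.add_self_eq_zero]
  have he := AddSubgroup.eq_of_le_of_card_ge hle h2.le
  have : x ∈ (addSelfMap σ).range := by rwa [he, AddMonoidHom.mem_ker]
  exact this

end FixedField

/-! ### The criterion for a unique zero. -/

section UniqueZero

variable {F : Type*} [Field F] [CharP F 2] [Finite F] {σ : F →+* F} {a : F}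

theorem exists_parameter {n : ℕ} (hn : n ≠ 0)
    (hσ : ∀ x, σ^[n] x = x) (hmin : ∀ m, 0 < m → m < n → ∃ x, σ^[m] x ≠ x) {x : F}
    (ha : a ≠ 0) (hy : x * σ x + x + a = 0) (huniq : ∀ y, y * σ y + y + a = 0 → y = x) :
    ∃ s, s + σ s ≠ 0 ∧ s ≠ 0 ∧ x * (s + σ s) = σ s ∧ additiveTrace σ n s⁻¹ ≠ 0 := by
  obtain ⟨s, hs, hs0, hx⟩ := exists_parameter_of_unique_zero hy ha huniq
  refine ⟨s, hs, hs0, hx, fun h => ?_⟩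
  rw [← additiveTrace_map hσ, map_inv₀] at h
  obtain ⟨v, hv⟩ := exists_add_eq_of_additiveTrace_eq_zero hn hσ hmin h
  obtain ⟨y, hy1, hy2⟩ := exists_second_zero hs0 hx hy hv
  exact hy2 (huniq y hy1)

theorem existsUnique_zero_iff {n : ℕ} (hn : n ≠ 0)
    (hσ : ∀ x, σ^[n] x = x) (hmin : ∀ m, 0 < m → m < n → ∃ x, σ^[m] x ≠ x) (ha : a ≠ 0) :
    (∃! x, x * σ x + x + a = 0) ↔ twistedTrace σ a n = 0 ∧ twistedFib σ a n ≠ 0 := by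
  constructor
  · rintro ⟨x, hy, huniq⟩
    obtain ⟨s, hs, hs0, hx, hT⟩ := exists_parameter hn hσ hmin ha hy huniq
    exact ⟨twistedTrace_eq_zero hn hσ hs hs0 hx hy,
      (twistedFib_ne_zero_iff hn hσ hs hs0 hx hy).2 hT⟩
  · rintro ⟨hZ, hC⟩
    obtain ⟨x, hx⟩ := (bijective_frobenius F 2).2 (a * σ (twistedFib σ a n) / twistedFib σ a n)
    rw [frobenius_def, eq_div_iff hC] at hx
    refine ⟨x, zero_of_twistedTrace_eq_zero hn hσ hZ hC hx, fun y hy => ?_⟩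
    have h := quadratic_of_zero hn hσ hy
    rw [hZ, zero_mul, add_zero, CharTwo.add_eq_zero, ← hx, mul_comm] at h
    exact frobenius_inj F 2 (mul_right_cancel₀ hC h)

end UniqueZero

/-! ### Counting the parameters s. -/

section Counting

variable {F : Type*} [Field F] {σ : F →+* F}

/-- The ratio σ(s)/s = x/(1 - x) depends only on x, so s/t is fixed. -/
theorem exists_fixed_mul {s t x : F} (hs : s + σ s ≠ 0) (ht0 : t ≠ 0)
    (hxs : x * (s + σ s) = σ s) (hxt : x * (t + σ t) = σ t) :
    ∃ c, c ≠ 0 ∧ σ c = c ∧ c * t = s := by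
  have hs0 : s ≠ 0 := by rintro rfl; simp at hs
  refine ⟨s / t, div_ne_zero hs0 ht0, ?_, div_mul_cancel₀ s ht0⟩
  have hσt : σ t ≠ 0 := (map_ne_zero σ).2 ht0
  have hx1 : 1 - x ≠ 0 := by
    intro h
    have : s = (s + σ s) * (1 - x) := by linear_combination hxs
    rw [h, mul_zero] at this
    exact hs0 this
  rw [map_div₀, div_eq_div_iff hσt ht0]
  apply mul_left_cancel₀ hx1
  linear_combination s * hxt - t * hxs

theorem additiveTrace_of_fixed {n : ℕ} {x : F} (hx : σ x = x) :
    additiveTrace σ n x = n * x := by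
  simp [additiveTrace_apply, iterate_eq_of_map_eq hx]

variable [CharP F 2]

theorem ncard_fixed_trace_ne_zero_of_odd {n : ℕ} (hn : Odd n) :
    {x : F | σ x = x ∧ additiveTrace σ n x ≠ 0}.ncard =
      Nat.card {c : F // c ≠ 0 ∧ σ c = c} := by
  have h : (n : F) ≠ 0 := by
    rw [Ne, CharP.cast_eq_zero_iff F 2 n]; exact hn.not_two_dvd_nat
  refine congrArg Set.ncard (Set.ext fun x => ?_)
  simp only [Set.mem_ofPred_eq]
  refine ⟨fun hx => ⟨?_, hx.1⟩, fun hx => ⟨hx.2, ?_⟩⟩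
  · rintro rfl; simp at hx
  · rw [additiveTrace_of_fixed hx.2]; exact mul_ne_zero h hx.1

variable [Finite F]

theorem card_parameters_eq {n : ℕ} (hn : n ≠ 0) (hσ : ∀ x, σ^[n] x = x)
    (hmin : ∀ m, 0 < m → m < n → ∃ x, σ^[m] x ≠ x) :
    Nat.card {s : F // s + σ s ≠ 0 ∧ additiveTrace σ n s⁻¹ ≠ 0} =
      Nat.card {a : F // a ≠ 0 ∧ ∃! x, x * σ x + x + a = 0} *
        Nat.card {c : F // c ≠ 0 ∧ σ c = c} := by
  have hex (a : {a : F // a ≠ 0 ∧ ∃! x, x * σ x + x + a = 0}) : ∃ s x : F,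
      x * σ x + x + a = 0 ∧ s + σ s ≠ 0 ∧ s ≠ 0 ∧ x * (s + σ s) = σ s ∧
        additiveTrace σ n s⁻¹ ≠ 0 := by
    obtain ⟨x, hy, hu⟩ := a.2.2
    obtain ⟨s, h⟩ := exists_parameter hn hσ hmin a.2.1 hy hu
    exact ⟨s, x, hy, h⟩
  choose s x hy hs hs0 hx hT using hex
  have hmul (a) (c : F) (hc : σ c = c) : c * s a + σ (c * s a) = c * (s a + σ (s a)) := by
    rw [map_mul, hc]; ring
  let φ : {a : F // a ≠ 0 ∧ ∃! x, x * σ x + x + a = 0} × {c : F // c ≠ 0 ∧ σ c = c} →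
      {s : F // s + σ s ≠ 0 ∧ additiveTrace σ n s⁻¹ ≠ 0} := fun p =>
    ⟨p.2 * s p.1, by
      rw [hmul _ _ p.2.2.2]; exact mul_ne_zero p.2.2.1 (hs _), by
      rw [mul_inv, additiveTrace_mul n (by rw [map_inv₀, p.2.2.2])]
      exact mul_ne_zero (inv_ne_zero p.2.2.1) (hT _)⟩
  have hφ : Function.Bijective φ := by
    constructor
    · rintro ⟨a, c⟩ ⟨b, e⟩ h
      have h' : c.1 * s a = e.1 * s b := congrArg Subtype.val h
      have e1 : x a * (c * s a + σ (c * s a)) = σ (c * s a) := by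
        rw [hmul _ _ c.2.2, map_mul, c.2.2]; linear_combination c.1 * hx a
      have e2 : x b * (c * s a + σ (c * s a)) = σ (c * s a) := by
        rw [h', hmul _ _ e.2.2, map_mul, e.2.2]; linear_combination e.1 * hx b
      have hne : c * s a + σ (c * s a) ≠ 0 := by
        rw [hmul _ _ c.2.2]; exact mul_ne_zero c.2.1 (hs _)
      have hxx : x a = x b := mul_right_cancel₀ hne (e1.trans e2.symm)
      have ha := hy a
      rw [hxx] at ha
      have hab : a = b := Subtype.ext (add_left_cancel (ha.trans (hy b).symm))
      subst hab
      rw [mul_left_inj' (hs0 a)] at h'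
      rw [Subtype.ext h']
    · rintro ⟨t, ht, htT⟩
      have h2 := CharTwo.two_eq_zero (R := F)
      have ht0 : t ≠ 0 := by rintro rfl; simp at ht
      have hσt : σ t ≠ 0 := (map_ne_zero σ).2 ht0
      have hz : σ t / (t + σ t) * (t + σ t) = σ t := div_mul_cancel₀ _ ht
      set z := σ t / (t + σ t)
      have hz0 : z ≠ 0 := div_ne_zero hσt ht
      have hz1 : z + 1 ≠ 0 := by
        intro h
        have : t = (z + 1) * (t + σ t) := by linear_combination -hz - σ t * h2
        rw [h, zero_mul] at this
        exact ht0 this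
      -- The only a for which z is a zero is z σ(z + 1).
      have ha0 : z * σ (z + 1) ≠ 0 := mul_ne_zero hz0 ((map_ne_zero σ).2 hz1)
      have hza : z * σ z + z + z * σ (z + 1) = 0 := by
        rw [map_add, map_one]; linear_combination (z * σ z + z) * h2
      have hu : ∃! x, x * σ x + x + z * σ (z + 1) = 0 :=
        (existsUnique_zero_iff hn hσ hmin ha0).2 ⟨twistedTrace_eq_zero hn hσ ht ht0 hz hza,
          (twistedFib_ne_zero_iff hn hσ ht ht0 hz hza).2 htT⟩
      let a : {a : F // a ≠ 0 ∧ ∃! x, x * σ x + x + a = 0} := ⟨z * σ (z + 1), ha0, hu⟩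
      have hxa : x a = z := hu.unique (hy a) hza
      obtain ⟨c, hc0, hc, hcs⟩ := exists_fixed_mul ht (hs0 a) hz (hxa ▸ hx a)
      exact ⟨(a, ⟨c, hc0, hc⟩), Subtype.ext hcs⟩
  rw [← Nat.card_prod]
  exact (Nat.card_congr (Equiv.ofBijective φ hφ)).symm

theorem card_parameters_add (σ : F →+* F) (n : ℕ) :
    Nat.card {s : F // s + σ s ≠ 0 ∧ additiveTrace σ n s⁻¹ ≠ 0} +
      {x : F | σ x = x ∧ additiveTrace σ n x ≠ 0}.ncard + Nat.card (additiveTrace σ n).ker =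
        Nat.card F := by
  have h1 := Set.ncard_add_ncard_compl ((additiveTrace σ n).ker : Set F)
  have h2 := Set.ncard_inter_add_ncard_sdiff_eq_ncard
    ((additiveTrace σ n).ker : Set F)ᶜ {x : F | σ x = x}
  have h3 : Nat.card {s : F // s + σ s ≠ 0 ∧ additiveTrace σ n s⁻¹ ≠ 0} =
      (((additiveTrace σ n).ker : Set F)ᶜ \ {x : F | σ x = x}).ncard := by
    -- Inversion preserves being fixed; the convention 0⁻¹ = 0 is harmless, as 0 lies in neither
    -- set.
    refine Nat.card_congr ((Equiv.inv F).subtypeEquiv fun s => ?_)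
    simp [and_comm, CharTwo.add_eq_zero (R := F), eq_comm (a := s)]
  have h4 : {x : F | σ x = x ∧ additiveTrace σ n x ≠ 0} =
      ((additiveTrace σ n).ker : Set F)ᶜ ∩ {x : F | σ x = x} := by
    ext x; simp [and_comm]
  have h5 : Nat.card (additiveTrace σ n).ker = ((additiveTrace σ n).ker : Set F).ncard := rfl
  rw [h3, h4, h5]
  omega

theorem ncard_fixed_trace_ne_zero_of_even {n : ℕ} (hn : Even n) :
    {x : F | σ x = x ∧ additiveTrace σ n x ≠ 0}.ncard = 0 := by
  rw [Set.ncard_eq_zero, Set.eq_empty_iff_forall_notMem]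
  rintro x ⟨h1, h2⟩
  apply h2
  rw [additiveTrace_of_fixed h1, (CharP.cast_eq_zero_iff F 2 n).2 hn.two_dvd, zero_mul]

theorem card_ker_addSelfMap (σ : F →+* F) :
    Nat.card (addSelfMap σ).ker = Nat.card {c : F // c ≠ 0 ∧ σ c = c} + 1 := by
  have h : ((addSelfMap σ).ker : Set F) = insert 0 {c : F | c ≠ 0 ∧ σ c = c} := by
    ext x
    rw [SetLike.mem_coe, mem_ker_addSelfMap]
    by_cases hx : x = 0 <;> simp [hx]
  have h5 : Nat.card (addSelfMap σ).ker = ((addSelfMap σ).ker : Set F).ncard := rfl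
  rw [h5, h, Set.ncard_insert_of_notMem (by simp)]
  rfl

end Counting

/-! ### Specialisation to powers of Frobenius. -/

section GaloisField

variable {F : Type*} [Field F]

theorem polyC_eval [CharP F 2] (l : ℕ) (a : F) (i : ℕ) :
    (polyC F l i).eval a = twistedFib (iterateFrobenius F 2 l) a i := by
  induction i using Nat.twoStepInduction with
  | zero => simp [polyC, twistedFib]
  | one => simp [polyC, twistedFib]
  | more i h0 h1 =>
    rw [polyC, twistedFib_add_two, ← h0, ← h1, ← coe_iterateFrobenius_mul, iterateFrobenius_def,
      mul_comm l i]
    simp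

theorem polyZ_eval [CharP F 2] (l : ℕ) (a : F) (n : ℕ) :
    (polyZ F l n).eval a = twistedTrace (iterateFrobenius F 2 l) a n := by
  simp [polyZ, twistedTrace, polyC_eval, iterateFrobenius_def]

theorem mem_zerosP [CharP F 2] (l : ℕ) (a x : F) :
    x ∈ zerosP l a ↔ x * iterateFrobenius F 2 l x + x + a = 0 := by
  simp [zerosP, polyP, iterateFrobenius_def, pow_succ']

theorem zerosP_ncard_eq_one [CharP F 2] (l : ℕ) (a : F) :
    (zerosP l a).ncard = 1 ↔ ∃! x, x * iterateFrobenius F 2 l x + x + a = 0 := by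
  rw [Set.ncard_eq_one]
  refine exists_congr fun x => ?_
  simp only [Set.eq_singleton_iff_unique_mem, mem_zerosP]

theorem charP_two_of_card [Finite F] {k : ℕ} (hF : Nat.card F = 2 ^ k) : CharP F 2 := by
  obtain ⟨p, hp⟩ := CharP.exists F
  have := Fintype.ofFinite F
  obtain ⟨m, hpp, hm⟩ := FiniteField.card F p
  rw [← Nat.card_eq_fintype_card, hF] at hm
  have : p ∣ 2 ^ k := hm ▸ dvd_pow_self p m.ne_zero
  have : p = 2 := (Nat.prime_dvd_prime_iff_eq hpp Nat.prime_two).1 (hpp.dvd_of_dvd_pow this)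
  exact this ▸ hp

/-- Nonzero fixed elements are the kernel of u ↦ u^(2^m - 1) on a cyclic group of order 2^k - 1. -/
theorem card_fixed_iterateFrobenius [Finite F] [CharP F 2] {k : ℕ} (hF : Nat.card F = 2 ^ k)
    (m : ℕ) :
    Nat.card {c : F // c ≠ 0 ∧ iterateFrobenius F 2 m c = c} = 2 ^ Nat.gcd k m - 1 := by
  have h := IsCyclic.card_powMonoidHom_ker (G := Fˣ) (2 ^ m - 1)
  rw [Nat.card_units, hF, Nat.pow_sub_one_gcd_pow_sub_one] at h
  rw [← h]
  have hu (u : Fˣ) : u ∈ (powMonoidHom (2 ^ m - 1) : Fˣ →* Fˣ).ker ↔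
      iterateFrobenius F 2 m (u : F) = u := by
    rw [MonoidHom.mem_ker, powMonoidHom_apply, iterateFrobenius_def, Units.ext_iff,
      ← mul_left_inj' u.ne_zero]
    push_cast
    rw [← pow_succ, Nat.sub_add_cancel Nat.one_le_two_pow, one_mul]
  refine (Nat.card_congr (Equiv.ofBijective
    (fun u : (powMonoidHom (2 ^ m - 1) : Fˣ →* Fˣ).ker =>
      (⟨u.1, u.1.ne_zero, (hu _).1 u.2⟩ : {c : F // c ≠ 0 ∧ iterateFrobenius F 2 m c = c}))
    ⟨fun u v h => ?_, fun c => ?_⟩)).symm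
  · exact Subtype.ext (Units.ext (congrArg Subtype.val h))
  · exact ⟨⟨Units.mk0 c.1 c.2.1, (hu _).2 c.2.2⟩, rfl⟩

theorem iterateFrobenius_eq_self_of_dvd [Finite F] [CharP F 2] {k : ℕ} (hF : Nat.card F = 2 ^ k)
    {m : ℕ} (hm : k ∣ m) (x : F) : iterateFrobenius F 2 m x = x := by
  have := Fintype.ofFinite F
  obtain ⟨j, rfl⟩ := hm
  rw [coe_iterateFrobenius_mul]
  apply Function.iterate_fixed
  rw [iterateFrobenius_def, ← hF, Nat.card_eq_fintype_card, FiniteField.pow_card]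

theorem dvd_of_iterateFrobenius_eq_self [Finite F] [CharP F 2] {k : ℕ}
    (hF : Nat.card F = 2 ^ k) {m : ℕ} (h : ∀ x : F, iterateFrobenius F 2 m x = x) : k ∣ m := by
  have h1 := card_fixed_iterateFrobenius hF m
  have h2 := card_fixed_iterateFrobenius hF k
  simp only [h, iterateFrobenius_eq_self_of_dvd hF dvd_rfl] at h1 h2
  rw [Nat.gcd_self] at h2
  have h3 : 2 ^ Nat.gcd k m = 2 ^ k := by
    have := Nat.one_le_two_pow (n := k)
    have := Nat.one_le_two_pow (n := Nat.gcd k m)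
    omega
  exact Nat.gcd_eq_left_iff_dvd.1 (Nat.pow_right_injective le_rfl h3)

end GaloisField

theorem mainTheorem4 {F : Type*} [Field F] [Finite F] (k l d n : ℕ)
    (hF : Nat.card F = 2 ^ k) (hl : 0 < l) (hlk : l < k)
    (hd : d = Nat.gcd l k) (hn : k = n * d) :
    (∀ a : F, a ≠ 0 →
      ((zerosP l a).ncard = 1 ↔ (polyZ F l n).eval a = 0 ∧ (polyC F l n).eval a ≠ 0) ∧
      ((zerosP l a).ncard = 1 →
        zerosP l a = {(a * (polyC F l n).eval a ^ (2 ^ l - 1)) ^ (2 ^ (k - 1))})) ∧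
    (Odd n → countM F l 1 = 2 ^ (k - d) - 1) ∧
    (Even n → countM F l 1 = 2 ^ (k - d)) := by
  have := charP_two_of_card hF
  have hk : k ≠ 0 := by omega
  have hn0 : n ≠ 0 := by rintro rfl; simp at hn; exact hk hn
  have hd0 : 0 < d := hd ▸ Nat.gcd_pos_of_pos_left k hl
  obtain ⟨l', hl'⟩ : d ∣ l := hd ▸ Nat.gcd_dvd_left l k
  have hcop : Nat.Coprime n l' := by
    have : d * Nat.gcd l' n = d * 1 := by
      rw [← Nat.gcd_mul_left, ← hl', mul_comm d n, ← hn, ← hd, mul_one]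
    rw [Nat.coprime_comm]
    exact Nat.eq_of_mul_eq_mul_left hd0 this
  set σ := iterateFrobenius F 2 l with hσdef
  have hσ (x : F) : σ^[n] x = x := by
    rw [← coe_iterateFrobenius_mul]
    refine iterateFrobenius_eq_self_of_dvd hF ⟨l', ?_⟩ x
    rw [hn, hl']; ring
  -- If σ^m = id, then k = n d divides l m = d l' m, so n divides m because n and l' are coprime.
  have hmin (m : ℕ) (hm0 : 0 < m) (hmn : m < n) : ∃ x, σ^[m] x ≠ x := by
    by_contra! h
    simp only [← coe_iterateFrobenius_mul, hσdef] at h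
    have h1 := dvd_of_iterateFrobenius_eq_self hF h
    rw [hn, hl', mul_comm n d, mul_assoc] at h1
    have h2 := hcop.dvd_of_dvd_mul_left (Nat.dvd_of_mul_dvd_mul_left hd0 h1)
    exact absurd (Nat.le_of_dvd hm0 h2) (by omega)
  have hiff (a : F) (ha : a ≠ 0) : (zerosP l a).ncard = 1 ↔
      (polyZ F l n).eval a = 0 ∧ (polyC F l n).eval a ≠ 0 := by
    rw [zerosP_ncard_eq_one, polyZ_eval, polyC_eval]
    exact existsUnique_zero_iff hn0 hσ hmin ha
  refine ⟨fun a ha => ⟨hiff a ha, fun h => ?_⟩, ?_⟩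
  · obtain ⟨hZ, hC⟩ := (hiff a ha).1 h
    obtain ⟨x, hx⟩ := Set.ncard_eq_one.1 h
    rw [hx]
    congr 1
    have hq := quadratic_of_zero hn0 hσ ((mem_zerosP l a x).1 (hx ▸ rfl))
    rw [← polyZ_eval, hZ, zero_mul, add_zero, CharTwo.add_eq_zero, ← polyC_eval, hσdef,
      iterateFrobenius_def] at hq
    have hx2 : x ^ 2 = a * (polyC F l n).eval a ^ (2 ^ l - 1) := by
      apply mul_left_cancel₀ hC
      rw [hq, mul_left_comm, ← pow_succ', Nat.sub_add_cancel Nat.one_le_two_pow]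
    -- Raising to the power 2^(k-1) inverts squaring, since x^(2^k) = x.
    rw [← hx2, ← pow_mul, ← pow_succ', Nat.sub_add_cancel (by omega)]
    exact (iterateFrobenius_eq_self_of_dvd hF dvd_rfl x).symm
  · have hM : countM F l 1 = Nat.card {a : F // a ≠ 0 ∧ ∃! x, x * σ x + x + a = 0} := by
      simp only [countM, zerosP_ncard_eq_one]
      rfl
    have hK : Nat.card {c : F // c ≠ 0 ∧ σ c = c} = 2 ^ d - 1 := by
      rw [card_fixed_iterateFrobenius hF, Nat.gcd_comm, ← hd]
    have hKd : Nat.card (addSelfMap σ).ker = 2 ^ d := by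
      rw [card_ker_addSelfMap, hK, Nat.sub_add_cancel Nat.one_le_two_pow]
    have hdk : d ≤ k := hn ▸ Nat.le_mul_of_pos_left d (Nat.pos_of_ne_zero hn0)
    have hT : Nat.card (additiveTrace σ n).ker = 2 ^ (k - d) := by
      have h := card_ker_additiveTrace_mul hn0 hσ hmin
      rw [hKd, hF, ← Nat.sub_add_cancel hdk, pow_add] at h
      exact Nat.eq_of_mul_eq_mul_right (by positivity) h
    have hS := card_parameters_add σ n
    rw [card_parameters_eq hn0 hσ hmin, ← hM, hK, hT, hF] at hS
    have hpos : 0 < 2 ^ d - 1 := Nat.sub_pos_of_lt (Nat.one_lt_two_pow hd0.ne')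
    have hpow : 2 ^ k = (2 ^ d - 1) * 2 ^ (k - d) + 2 ^ (k - d) := by
      rw [← Nat.succ_mul, Nat.succ_eq_add_one, Nat.sub_add_cancel Nat.one_le_two_pow, ← pow_add,
        Nat.add_sub_cancel' hdk]
    rw [hpow, Nat.add_right_cancel_iff, mul_comm (countM F l 1)] at hS
    -- `hS` now says that (2^d - 1) M_1 plus the number of fixed elements of nonzero trace is (2^d -
    -- 1) 2^(k-d).
    constructor
    · intro hodd
      rw [ncard_fixed_trace_ne_zero_of_odd hodd, hK, ← Nat.mul_succ] at hS
      have := Nat.eq_of_mul_eq_mul_left hpos hS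
      omega
    · intro heven
      rw [ncard_fixed_trace_ne_zero_of_even heven, add_zero] at hS
      exact Nat.eq_of_mul_eq_mul_left hpos hS
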